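/- Let $p$ be a positive integer and let $\alpha_1,\ldots,\alpha_p$, $\beta_1,\ldots,\beta_p$ be real numbers satisfying $$0<\alpha_1\le\alpha_2\le\cdots\le\alpha_p,\qquad 0<\beta_1\le\beta_2\le\cdots\le\beta_p,\qquad \sum_{j=1}^{k}\alpha_j\le\sum_{j=1}^{k}\beta_j\quad\text{for } k=1,\ldots,p.$$ Put $A_i=1/\alpha_i$, $B_i=1/\beta_i$ for $i=1,\ldots,p$, and let $Y>X>0$. Then the function $$F(a)=\prod_{i=1}^{p}\frac{\Gamma(A_iX+a)\,\Gamma(B_iY+a)}{\Gamma(A_iY+a)\,\Gamma(B_iX+a)}$$ is monotone decreasing (in the non-strict sense: $F(a)\ge F(b)$ whenever $1\le a\le b$) on $[1,\infty)$. -/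

import Mathlib

/-- The majorization conditions on two tuples of reals `α = (α₁, …, α_p)`, `β = (β₁, …, β_p)`:
both are positive and nondecreasing, and every partial sum of `α` is at most the
corresponding partial sum of `β`. -/
structure MajorizationConditions {p : ℕ} (α β : Fin p → ℝ) : Prop where
  pos_left : ∀ i, 0 < α i
  mono_left : ∀ i j, i ≤ j → α i ≤ α j
  pos_right : ∀ i, 0 < β i
  mono_right : ∀ i j, i ≤ j → β i ≤ β j
  sum_le : ∀ k : Fin p, ∑ j ∈ Finset.Iic k, α j ≤ ∑ j ∈ Finset.Iic k, β j

/-- The ratio of products of gamma functions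
`∏ᵢ Γ(Aᵢ X + a) Γ(Bᵢ Y + a) / (Γ(Aᵢ Y + a) Γ(Bᵢ X + a))`. -/
noncomputable def gammaRatio {p : ℕ} (A B : Fin p → ℝ) (X Y a : ℝ) : ℝ :=
  ∏ i, (Real.Gamma (A i * X + a) * Real.Gamma (B i * Y + a)) /
    (Real.Gamma (A i * Y + a) * Real.Gamma (B i * X + a))

/-! Write `g s = ψ(Y/s + a) - ψ(X/s + a)`. The derivative of `log F` is `∑ g (β i) - ∑ g (α i)`, so
it suffices that `g` be convex and nonincreasing on `s > 0`. Tangent lines of `g` at the `β i`,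
followed by Abel summation against the partial sums of `α - β`, then give the sign
(`tangent_le_of_monotoneOn_deriv`, `sum_mul_nonneg_of_partial_sums`).

Convexity of `g` follows if the second `s`-derivative of `ψ(y/s + a)` increases with `y`, which
amounts to convexity of `x² ψ'(x + a)`. This is proved by telescoping (`mixedDeriv_nonneg`).

Digamma itself is avoided: the series is cut after `n` terms and its tail replaced by a logarithm,
so that convexity and monotonicity hold exactly for every `n`. Compared with Gauss's product for
`Γ`, the logarithms cost only `O(1/n)` in the derivative, which vanishes in the limit. -/

/-! ### Telescoping inequality for the mixed derivative -/

/-- One step of the telescoping comparison behind the convexity of `x ↦ x² ψ'(x + a)`. -/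
lemma telescoping_step {c x : ℝ} (hc : 1 ≤ c) (hx : 0 ≤ x) :
    c * (c - 1) / (x + c - 1 / 2) ^ 3 ≤
      c * (c - 2 * x) / (x + c) ^ 4 + (c + 1) * c / (x + c + 1 / 2) ^ 3 := by
  -- In terms of `w = x + c` the denominators are free of `c`, and the numerator has nonnegative
  -- coefficients in `w - c` and `c`.
  obtain ⟨w, rfl⟩ : ∃ w, x = w - c := ⟨x + c, by ring⟩
  have hw : 1 ≤ w := by linarith
  have h1 : 0 < w - 1 / 2 := by linarith
  have h2 : 0 < w + 1 / 2 := by linarith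
  have h0 : 0 < w := by linarith
  have key : c * (c - 2 * (w - c)) / w ^ 4 + (c + 1) * c / (w + 1 / 2) ^ 3
      - c * (c - 1) / (w - 1 / 2) ^ 3 =
      c * ((w - c) * (5 / 2 * w ^ 4) + w ^ 3 * (1 / 2 * w ^ 2 - 3 / 8) + w / 32
        + c * (9 / 16 * w ^ 2 - 3 / 64)) / (w ^ 4 * (w + 1 / 2) ^ 3 * (w - 1 / 2) ^ 3) := by
    have h1' : 2 * w - 1 ≠ 0 := by linarith
    field_simp
    ring
  have h3 : 0 ≤ 1 / 2 * w ^ 2 - 3 / 8 := by nlinarith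
  have h4 : 0 ≤ 9 / 16 * w ^ 2 - 3 / 64 := by nlinarith
  have h5 : 0 ≤ c := by linarith
  have h6 : 0 ≤ w - c := by linarith
  have := key.symm ▸ (by positivity : 0 ≤ c * ((w - c) * (5 / 2 * w ^ 4)
    + w ^ 3 * (1 / 2 * w ^ 2 - 3 / 8) + w / 32
        + c * (9 / 16 * w ^ 2 - 3 / 64)) / (w ^ 4 * (w + 1 / 2) ^ 3 * (w - 1 / 2) ^ 3))
  rw [sub_add_cancel]
  linarith

/-- As a function of `c`, `c (c - 2x) / (x + c)^4` has antiderivative `-c² / (x + c)^3`. The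
boundary term is the midpoint estimate of the tail, `c²` at `c - 1/2`, with its numerator lowered by
`1/4` to `c (c - 1)`. -/
lemma telescoping_sum {a x : ℝ} (ha : 1 ≤ a) (hx : 0 ≤ x) (n : ℕ) :
    a * (a - 1) / (x + a - 1 / 2) ^ 3 ≤
      ∑ j ∈ Finset.range n, (a + j) * (a + j - 2 * x) / (x + (a + j)) ^ 4
        + (a + n) * (a + n - 1) / (x + (a + n) - 1 / 2) ^ 3 := by
  induction n with
  | zero => simp
  | succ n ih =>
    rw [Finset.sum_range_succ]
    have h := telescoping_step (c := a + n) (x := x)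
      (by linarith [(Nat.cast_nonneg n : (0 : ℝ) ≤ n)]) hx
    have e : (a + n + 1) * (a + n) / (x + (a + n) + 1 / 2) ^ 3 =
      (a + (n + 1 : ℕ)) * (a + (n + 1 : ℕ) - 1) / (x + (a + (n + 1 : ℕ)) - 1 / 2) ^ 3 := by
      push_cast
      ring_nf
    linarith

/-- The third mixed derivative of `K`, up to the factor `2`, is nonnegative. -/
lemma mixedDeriv_nonneg {a y s : ℝ} (ha : 1 ≤ a) (hy : 0 ≤ y) (hs : 0 < s) (n : ℕ) :
    0 ≤ (a + n - 1 / 2) ^ 2 / (y + (a + n - 1 / 2) * s) ^ 3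
      + ∑ j ∈ Finset.range n, (a + j) * (s * (a + j) - 2 * y) / (y + s * (a + j)) ^ 4 := by
  obtain ⟨x, rfl⟩ : ∃ x, y = s * x := ⟨y / s, by field_simp⟩
  have hx : 0 ≤ x := nonneg_of_mul_nonneg_right hy hs
  have hn : (0 : ℝ) ≤ n := Nat.cast_nonneg n
  have e1 : (a + n - 1 / 2) ^ 2 / (s * x + (a + n - 1 / 2) * s) ^ 3 =
      (s ^ 3)⁻¹ * ((a + n - 1 / 2) ^ 2 / (x + (a + n) - 1 / 2) ^ 3) := by
    rw [show s * x + (a + n - 1 / 2) * s = s * (x + (a + n) - 1 / 2) by ring, mul_pow,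
      div_mul_eq_div_div_swap, div_eq_inv_mul _ (s ^ 3)]
  have e2 : ∀ j ∈ Finset.range n,
      (a + j) * (s * (a + j) - 2 * (s * x)) / (s * x + s * (a + j)) ^ 4 =
      (s ^ 3)⁻¹ * ((a + j) * (a + j - 2 * x) / (x + (a + j)) ^ 4) := by
    intro j _
    have hj : 0 < x + (a + j) := by linarith [(Nat.cast_nonneg j : (0 : ℝ) ≤ j)]
    rw [← mul_add s]
    field_simp
  rw [e1, Finset.sum_congr rfl e2, ← Finset.mul_sum, ← mul_add]
  have h := telescoping_sum ha hx n
  -- The condition `a ≥ 1` makes the initial boundary term nonnegative.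
  have h0 : 0 ≤ a * (a - 1) / (x + a - 1 / 2) ^ 3 :=
    div_nonneg (mul_nonneg (by linarith) (by linarith)) (pow_nonneg (by linarith) _)
  -- The numerators differ by exactly `1/4`.
  have h1 : (a + n) * (a + n - 1) / (x + (a + n) - 1 / 2) ^ 3 ≤
      (a + n - 1 / 2) ^ 2 / (x + (a + n) - 1 / 2) ^ 3 := by
    apply div_le_div_of_nonneg_right _ (pow_nonneg (by linarith) _)
    nlinarith
  exact mul_nonneg (by positivity) (by linarith)

/-! ### Truncated digamma: convexity and monotonicity in `s` -/

/-- A smoothed truncation of `s ↦ ψ(y / s + a)`, up to a summand independent of `y`. -/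
noncomputable def truncDigamma (n : ℕ) (a y s : ℝ) : ℝ :=
  Real.log (y + (a + n - 1 / 2) * s) - ∑ j ∈ Finset.range n, s / (y + s * (a + j))

/-- The first derivative of `truncDigamma` in `s`. -/
noncomputable def truncDigammaDeriv (n : ℕ) (a y s : ℝ) : ℝ :=
  (a + n - 1 / 2) / (y + (a + n - 1 / 2) * s) - ∑ j ∈ Finset.range n, y / (y + s * (a + j)) ^ 2

/-- The second derivative of `truncDigamma` in `s`. -/
noncomputable def truncDigammaDeriv2 (n : ℕ) (a y s : ℝ) : ℝ :=
  -(a + n - 1 / 2) ^ 2 / (y + (a + n - 1 / 2) * s) ^ 2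
    + ∑ j ∈ Finset.range n, 2 * (y * (a + j)) / (y + s * (a + j)) ^ 3

section

variable {a y s : ℝ}

lemma add_mul_shift_pos (ha : 1 ≤ a) (hy : 0 < y) (hs : 0 < s) (j : ℕ) :
    0 < y + s * (a + j) := by positivity

lemma shift_pos (ha : 1 ≤ a) (n : ℕ) : 0 < a + n - 1 / 2 := by
  linarith [(Nat.cast_nonneg n : (0 : ℝ) ≤ n)]

lemma hasDerivAt_truncDigamma (ha : 1 ≤ a) (hy : 0 < y) (hs : 0 < s) (n : ℕ) :
    HasDerivAt (truncDigamma n a y) (truncDigammaDeriv n a y s) s := by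
  have hc := shift_pos ha n
  unfold truncDigammaDeriv
  refine HasDerivAt.sub (f := fun s => Real.log (y + (a + n - 1 / 2) * s))
    (g := fun s => ∑ j ∈ Finset.range n, s / (y + s * (a + j))) ?_
    (HasDerivAt.fun_sum fun j _ => ?_)
  · have := (((hasDerivAt_id s).const_mul (a + n - 1 / 2)).const_add y).log
      (by simp only [id]; positivity)
    simpa using this
  · have hj := add_mul_shift_pos ha hy hs j
    have := (hasDerivAt_id s).div (((hasDerivAt_id s).mul_const (a + j)).const_add y) hj.ne'
    refine this.congr_deriv ?_
    simp only [id]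
    congr 1
    ring

lemma hasDerivAt_truncDigammaDeriv (ha : 1 ≤ a) (hy : 0 < y) (hs : 0 < s) (n : ℕ) :
    HasDerivAt (truncDigammaDeriv n a y) (truncDigammaDeriv2 n a y s) s := by
  have hc := shift_pos ha n
  have hd : 0 < y + (a + n - 1 / 2) * s := by positivity
  unfold truncDigammaDeriv2
  rw [← sub_neg_eq_add, ← Finset.sum_neg_distrib]
  refine HasDerivAt.sub (f := fun s => (a + n - 1 / 2) / (y + (a + n - 1 / 2) * s))
    (g := fun s => ∑ j ∈ Finset.range n, y / (y + s * (a + j)) ^ 2) ?_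
    (HasDerivAt.fun_sum fun j _ => ?_)
  · have := (hasDerivAt_const s (a + n - 1 / 2)).div
      (((hasDerivAt_id s).const_mul (a + n - 1 / 2)).const_add y) hd.ne'
    refine this.congr_deriv ?_
    simp only [id]
    congr 1
    ring
  · have hj := add_mul_shift_pos ha hy hs j
    have := (hasDerivAt_const s y).div
      ((((hasDerivAt_id s).mul_const (a + j)).const_add y).pow 2) (pow_ne_zero 2 hj.ne')
    refine this.congr_deriv ?_
    simp only [id, Pi.pow_apply]
    field_simp
    ring

lemma hasDerivAt_truncDigammaDeriv2_left (ha : 1 ≤ a) (hy : 0 < y) (hs : 0 < s) (n : ℕ) :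
    HasDerivAt (fun y => truncDigammaDeriv2 n a y s)
      (2 * ((a + n - 1 / 2) ^ 2 / (y + (a + n - 1 / 2) * s) ^ 3
      + ∑ j ∈ Finset.range n, (a + j) * (s * (a + j) - 2 * y) / (y + s * (a + j)) ^ 4)) y := by
  have hc := shift_pos ha n
  have hd : 0 < y + (a + n - 1 / 2) * s := by positivity
  rw [mul_add, Finset.mul_sum]
  refine HasDerivAt.add (f := fun y => -(a + n - 1 / 2) ^ 2 / (y + (a + n - 1 / 2) * s) ^ 2)
    (g := fun y => ∑ j ∈ Finset.range n, 2 * (y * (a + j)) / (y + s * (a + j)) ^ 3) ?_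
    (HasDerivAt.fun_sum fun j _ => ?_)
  · have := (hasDerivAt_const y (-(a + n - 1 / 2) ^ 2)).div
      (((hasDerivAt_id y).add_const ((a + n - 1 / 2) * s)).pow 2) (pow_ne_zero 2 hd.ne')
    refine this.congr_deriv ?_
    simp only [id, Pi.pow_apply]
    generalize a + n - 1 / 2 = c at *
    field_simp
    ring
  · have hj := add_mul_shift_pos ha hy hs j
    have := (((hasDerivAt_id y).mul_const (a + j)).const_mul 2).div
      (((hasDerivAt_id y).add_const (s * (a + j))).pow 3) (pow_ne_zero 3 hj.ne')
    refine this.congr_deriv ?_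
    simp only [id, Pi.pow_apply]
    generalize a + (j : ℝ) = c at *
    rw [← mul_div_assoc, div_eq_div_iff (by positivity) (by positivity)]
    push_cast
    ring

lemma truncDigammaDeriv2_mono (ha : 1 ≤ a) (hs : 0 < s) (n : ℕ) {X Y : ℝ} (hX : 0 < X)
    (hXY : X ≤ Y) : truncDigammaDeriv2 n a X s ≤ truncDigammaDeriv2 n a Y s := by
  have hd : ∀ y ∈ Set.Ioi (0 : ℝ), HasDerivAt (fun y => truncDigammaDeriv2 n a y s) _ y :=
    fun y hy => hasDerivAt_truncDigammaDeriv2_left ha hy hs n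
  refine monotoneOn_of_deriv_nonneg (convex_Ioi (0 : ℝ))
    (fun y hy => (hd y hy).continuousAt.continuousWithinAt) ?_ ?_ hX (hX.trans_le hXY) hXY
  · rw [interior_Ioi]
    exact fun y hy => (hd y hy).differentiableAt.differentiableWithinAt
  · rw [interior_Ioi]
    intro y hy
    rw [(hd y hy).deriv]
    exact mul_nonneg zero_le_two (mixedDeriv_nonneg ha (le_of_lt hy) hs n)

end

lemma truncDigammaDeriv_diff_monotoneOn {a X Y : ℝ} (ha : 1 ≤ a) (n : ℕ) (hX : 0 < X)
    (hXY : X ≤ Y) :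
    MonotoneOn (fun s => truncDigammaDeriv n a Y s - truncDigammaDeriv n a X s) (Set.Ioi 0) := by
  have hd : ∀ s ∈ Set.Ioi (0 : ℝ),
      HasDerivAt (fun s => truncDigammaDeriv n a Y s - truncDigammaDeriv n a X s) _ s :=
    fun s hs => (hasDerivAt_truncDigammaDeriv ha (hX.trans_le hXY) hs n).sub
      (hasDerivAt_truncDigammaDeriv ha hX hs n)
  refine monotoneOn_of_deriv_nonneg (convex_Ioi (0 : ℝ))
    (fun y hy => (hd y hy).continuousAt.continuousWithinAt) ?_ ?_
  · rw [interior_Ioi]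
    exact fun y hy => (hd y hy).differentiableAt.differentiableWithinAt
  · rw [interior_Ioi]
    intro s hs
    rw [(hd s hs).deriv]
    exact sub_nonneg.2 (truncDigammaDeriv2_mono ha hs n hX hXY)

lemma tendsto_truncDigammaDeriv {a : ℝ} (ha : 1 ≤ a) (n : ℕ) (y : ℝ) :
    Filter.Tendsto (truncDigammaDeriv n a y) Filter.atTop (nhds 0) := by
  have hc := shift_pos ha n
  have h1 : Filter.Tendsto (fun s => (a + n - 1 / 2) / (y + (a + n - 1 / 2) * s))
      Filter.atTop (nhds 0) :=
    (Filter.tendsto_atTop_add_const_left _ y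
      (Filter.tendsto_id.const_mul_atTop hc)).const_div_atTop _
  have h2 : Filter.Tendsto (fun s => ∑ j ∈ Finset.range n, y / (y + s * (a + j)) ^ 2)
      Filter.atTop (nhds (∑ _j ∈ Finset.range n, 0)) := by
    refine tendsto_finsetSum _ fun j _ => ?_
    have hj : 0 < a + j := by positivity
    exact ((Filter.tendsto_pow_atTop two_ne_zero).comp (Filter.tendsto_atTop_add_const_left _ y
      (Filter.tendsto_id.atTop_mul_const hj))).const_div_atTop _
  have h := h1.sub h2
  rwa [Finset.sum_const_zero, sub_zero] at h

/-- A nondecreasing function tending to `0` at infinity is nonpositive. -/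
lemma truncDigammaDeriv_diff_nonpos {a X Y s : ℝ} (ha : 1 ≤ a) (n : ℕ) (hX : 0 < X)
    (hXY : X ≤ Y) (hs : 0 < s) : truncDigammaDeriv n a Y s - truncDigammaDeriv n a X s ≤ 0 := by
  have h := (tendsto_truncDigammaDeriv ha n Y).sub (tendsto_truncDigammaDeriv ha n X)
  rw [sub_zero] at h
  refine ge_of_tendsto h ?_
  filter_upwards [Filter.eventually_ge_atTop s] with t ht
  exact truncDigammaDeriv_diff_monotoneOn ha n hX hXY hs (hs.trans_le ht) ht

/-! ### Tangent lines and weak majorization -/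

/-- A differentiable function with monotone derivative lies above its tangent lines. -/
lemma tangent_le_of_monotoneOn_deriv {k k' : ℝ → ℝ}
    (hk : ∀ s ∈ Set.Ioi (0 : ℝ), HasDerivAt k (k' s) s) (hm : MonotoneOn k' (Set.Ioi 0))
    {u v : ℝ} (hu : 0 < u) (hv : 0 < v) : k' v * (u - v) ≤ k u - k v := by
  rcases lt_trichotomy u v with h | rfl | h
  · obtain ⟨c, hc, e⟩ := exists_hasDerivAt_eq_slope k k' h
      (fun z hz => (hk z (hu.trans_le hz.1)).continuousAt.continuousWithinAt)
      (fun z hz => hk z (hu.trans hz.1))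
    have := hm (hu.trans hc.1) hv hc.2.le
    rw [eq_div_iff (by linarith)] at e
    nlinarith
  · simp
  · obtain ⟨c, hc, e⟩ := exists_hasDerivAt_eq_slope k k' h
      (fun z hz => (hk z (hv.trans_le hz.1)).continuousAt.continuousWithinAt)
      (fun z hz => hk z (hv.trans hz.1))
    have := hm hv (hv.trans hc.1) hc.1.le
    rw [eq_div_iff (by linarith)] at e
    nlinarith

/-- Abel summation: a nonpositive nondecreasing weight against nonpositive partial sums. -/
lemma sum_mul_nonneg_of_partial_sums {p : ℕ} (d δ : Fin p → ℝ) (hd : Monotone d)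
    (hd0 : ∀ i, d i ≤ 0) (hδ : ∀ k : Fin p, ∑ j ∈ Finset.Iic k, δ j ≤ 0) :
    0 ≤ ∑ i, d i * δ i := by
  induction p with
  | zero => simp
  | succ p ih =>
    -- Subtracting the last weight keeps the weights nondecreasing and nonpositive; what is left
    -- over is the last weight times the full sum, a product of two nonpositive numbers.
    have h := ih (fun i => d i.castSucc - d (Fin.last p)) (fun i => δ i.castSucc)
      (fun i j hij => sub_le_sub_right (hd (Fin.castSucc_le_castSucc_iff.2 hij)) _)
      (fun i => sub_nonpos.2 (hd (Fin.le_last _)))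
      (fun k => by
        have := hδ k.castSucc
        rwa [← Fin.map_castSuccEmb_Iic, Finset.sum_map] at this)
    have hl := hδ (Fin.last p)
    rw [show Finset.Iic (Fin.last p) = Finset.univ by ext i; simp [Fin.le_last]] at hl
    have e : ∑ i, d i * δ i = ∑ i : Fin p, (d i.castSucc - d (Fin.last p)) * δ i.castSucc
        + d (Fin.last p) * ∑ i, δ i := by
      rw [Fin.sum_univ_castSucc, Fin.sum_univ_castSucc, mul_add, Finset.mul_sum, ← add_assoc,
        ← Finset.sum_add_distrib]
      congr 2
      ext i
      ring
    rw [e]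
    exact add_nonneg h (mul_nonneg_of_nonpos_of_nonpos (hd0 _) hl)

/-- Tangents are taken at the `β i`, so that the slopes are ordered like `β` and serve as Abel
weights. -/
lemma sum_truncDigamma_diff_le {p : ℕ} {α β : Fin p → ℝ} (h : MajorizationConditions α β)
    {a X Y : ℝ} (ha : 1 ≤ a) (n : ℕ) (hX : 0 < X) (hXY : X ≤ Y) :
    ∑ i, (truncDigamma n a Y (β i) - truncDigamma n a X (β i)) ≤
      ∑ i, (truncDigamma n a Y (α i) - truncDigamma n a X (α i)) := by
  have hm := truncDigammaDeriv_diff_monotoneOn ha n hX hXY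
  have h1 := sum_mul_nonneg_of_partial_sums
    (fun i => truncDigammaDeriv n a Y (β i) - truncDigammaDeriv n a X (β i))
    (fun i => α i - β i)
    (fun i j hij => hm (h.pos_right i) (h.pos_right j) (h.mono_right i j hij))
    (fun i => truncDigammaDeriv_diff_nonpos ha n hX hXY (h.pos_right i))
    (fun k => by
      rw [Finset.sum_sub_distrib]
      exact sub_nonpos.2 (h.sum_le k))
  have h2 := h1.trans (Finset.sum_le_sum fun i _ => tangent_le_of_monotoneOn_deriv
    (k := fun s => truncDigamma n a Y s - truncDigamma n a X s)
    (fun s hs => (hasDerivAt_truncDigamma ha (hX.trans_le hXY) hs n).sub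
      (hasDerivAt_truncDigamma ha hX hs n)) hm (h.pos_left i) (h.pos_right i))
  rw [Finset.sum_sub_distrib] at h2
  exact sub_nonneg.1 h2

/-! ### Passage to the gamma function through Gauss's product -/

/-- The truncated digamma difference in the variable `1 / s`. -/
lemma sum_inv_diff_eq {a X Y s : ℝ} (ha : 1 ≤ a) (hX : 0 < X) (hY : 0 < Y) (hs : 0 < s) (n : ℕ) :
    ∑ j ∈ Finset.range n, (1 / (1 / s * X + a + j) - 1 / (1 / s * Y + a + j)) =
      truncDigamma n a Y s - truncDigamma n a X s
      - (Real.log (Y + (a + n - 1 / 2) * s) - Real.log (X + (a + n - 1 / 2) * s)) := by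
  have e : ∀ z : ℝ, 0 < z → ∀ j : ℕ, 1 / (1 / s * z + a + j) = s / (z + s * (a + j)) := by
    intro z hz j
    have := add_mul_shift_pos ha hz hs j
    have h2 : 0 < 1 / s * z + a + j := by positivity
    rw [div_eq_div_iff h2.ne' this.ne']
    field_simp
    ring
  unfold truncDigamma
  simp only [e X hX, e Y hY, Finset.sum_sub_distrib]
  ring

lemma log_diff_nonneg {c X Y s : ℝ} (hc : 0 < c) (hX : 0 < X) (hXY : X ≤ Y) (hs : 0 < s) :
    0 ≤ Real.log (Y + c * s) - Real.log (X + c * s) :=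
  sub_nonneg.2 (Real.log_le_log (by positivity) (by linarith))

lemma log_diff_le {c X Y s : ℝ} (hc : 0 < c) (hX : 0 < X) (hXY : X ≤ Y) (hs : 0 < s) :
    Real.log (Y + c * s) - Real.log (X + c * s) ≤ 1 / s * Y / c := by
  have h1 : 0 < X + c * s := by positivity
  have h2 : 0 < Y + c * s := by linarith
  rw [← Real.log_div h2.ne' h1.ne']
  refine (Real.log_le_sub_one_of_pos (by positivity)).trans ?_
  rw [show (Y + c * s) / (X + c * s) - 1 = (Y - X) / (X + c * s) by field_simp; ring,
    show 1 / s * Y / c = Y / (c * s) by field_simp]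
  exact div_le_div₀ (by linarith) (by linarith) (by positivity) (by linarith)

open Real.BohrMollerup in
lemma hasDerivAt_logGammaSeq {z a : ℝ} (hz : 0 < z + a) (n : ℕ) :
    HasDerivAt (fun a => logGammaSeq (z + a) n)
      (Real.log n - ∑ j ∈ Finset.range (n + 1), 1 / (z + a + j)) a := by
  unfold logGammaSeq
  refine HasDerivAt.sub (f := fun a => (z + a) * Real.log n + Real.log n.factorial)
    (g := fun a => ∑ j ∈ Finset.range (n + 1), Real.log (z + a + j)) ?_
    (HasDerivAt.fun_sum fun j _ => ?_)
  · simpa using (((hasDerivAt_id a).const_add z).mul_const (Real.log n)).add_const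
      (Real.log n.factorial)
  · exact ((((hasDerivAt_id a).const_add z).add_const (j : ℝ))).log (by simp only [id]; positivity)

/-- The logarithm of the gamma ratio with each gamma function replaced by Gauss's product. -/
noncomputable def logGammaRatioSeq {p : ℕ} (A B : Fin p → ℝ) (X Y a : ℝ) (n : ℕ) : ℝ :=
  ∑ i, (Real.BohrMollerup.logGammaSeq (A i * X + a) n
    + Real.BohrMollerup.logGammaSeq (B i * Y + a) n
    - (Real.BohrMollerup.logGammaSeq (A i * Y + a) n
    + Real.BohrMollerup.logGammaSeq (B i * X + a) n))

section

variable {p : ℕ} {A B : Fin p → ℝ} {X Y a : ℝ}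

lemma tendsto_logGammaRatioSeq (hA : ∀ i, 0 < A i) (hB : ∀ i, 0 < B i) (hX : 0 < X) (hY : 0 < Y)
    (ha : 0 < a) :
    Filter.Tendsto (logGammaRatioSeq A B X Y a) Filter.atTop
      (nhds (Real.log (gammaRatio A B X Y a))) := by
  have hpos : ∀ {u v : ℝ}, 0 < u → 0 < v → 0 < u * v + a := fun hu hv => by positivity
  have hG : ∀ {u v : ℝ}, 0 < u → 0 < v → Real.Gamma (u * v + a) ≠ 0 :=
    fun hu hv => (Real.Gamma_pos_of_pos (hpos hu hv)).ne'
  unfold gammaRatio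
  rw [Real.log_prod fun i _ => div_ne_zero (mul_ne_zero (hG (hA i) hX) (hG (hB i) hY))
    (mul_ne_zero (hG (hA i) hY) (hG (hB i) hX))]
  refine tendsto_finsetSum _ fun i _ => ?_
  rw [Real.log_div (mul_ne_zero (hG (hA i) hX) (hG (hB i) hY))
    (mul_ne_zero (hG (hA i) hY) (hG (hB i) hX)), Real.log_mul (hG (hA i) hX) (hG (hB i) hY),
    Real.log_mul (hG (hA i) hY) (hG (hB i) hX)]
  have hT := fun {u v : ℝ} (hu : 0 < u) (hv : 0 < v) =>
    Real.BohrMollerup.tendsto_log_gamma (hpos hu hv)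
  exact ((hT (hA i) hX).add (hT (hB i) hY)).sub ((hT (hA i) hY).add (hT (hB i) hX))

lemma hasDerivAt_logGammaRatioSeq (hA : ∀ i, 0 < A i) (hB : ∀ i, 0 < B i) (hX : 0 < X)
    (hY : 0 < Y) (ha : 0 < a) (n : ℕ) :
    HasDerivAt (fun a => logGammaRatioSeq A B X Y a n)
      (∑ i, ∑ j ∈ Finset.range (n + 1), (1 / (B i * X + a + j) - 1 / (B i * Y + a + j))
        - ∑ i, ∑ j ∈ Finset.range (n + 1), (1 / (A i * X + a + j) - 1 / (A i * Y + a + j))) a := by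
  have hD := fun {u v : ℝ} (hu : 0 < u) (hv : 0 < v) =>
    hasDerivAt_logGammaSeq (z := u * v) (a := a) (by positivity) n
  unfold logGammaRatioSeq
  rw [← Finset.sum_sub_distrib]
  refine HasDerivAt.fun_sum fun i _ => ?_
  refine (((hD (hA i) hX).add (hD (hB i) hY)).sub
    ((hD (hA i) hY).add (hD (hB i) hX))).congr_deriv ?_
  simp only [Finset.sum_sub_distrib]
  ring

end

/-- The majorization inequality controls everything except the logarithmic corrections, which are
`O(1/n)`. -/
lemma logGammaRatioSeq_deriv_le {p : ℕ} {α β : Fin p → ℝ} (h : MajorizationConditions α β)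
    {a X Y : ℝ} (ha : 1 ≤ a) (n : ℕ) (hX : 0 < X) (hXY : X ≤ Y) :
    ∑ i, ∑ j ∈ Finset.range (n + 1), (1 / (1 / β i * X + a + j) - 1 / (1 / β i * Y + a + j))
        - ∑ i, ∑ j ∈ Finset.range (n + 1), (1 / (1 / α i * X + a + j) - 1 / (1 / α i * Y + a + j))
      ≤ (∑ i, 1 / α i * Y) / (n + 1) := by
  have hY := hX.trans_le hXY
  -- Gauss's product of index `n` has `n + 1` linear factors, hence truncation at `n + 1`.
  have hc := shift_pos ha (n + 1)
  have h1 := sum_truncDigamma_diff_le h ha (n + 1) hX hXY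
  rw [Finset.sum_congr rfl fun i _ => sum_inv_diff_eq ha hX hY (h.pos_right i) (n + 1),
    Finset.sum_congr rfl fun i _ => sum_inv_diff_eq ha hX hY (h.pos_left i) (n + 1)]
  -- The `β` logarithms enter with a favourable sign and are dropped; only those of `α` need a size
  -- bound.
  have h2 := Finset.sum_nonneg fun i (_ : i ∈ Finset.univ) =>
    log_diff_nonneg hc hX hXY (h.pos_right i)
  have h3 : ∑ i, (Real.log (Y + (a + (n + 1 : ℕ) - 1 / 2) * α i)
      - Real.log (X + (a + (n + 1 : ℕ) - 1 / 2) * α i)) ≤ (∑ i, 1 / α i * Y) / (n + 1) := by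
    rw [Finset.sum_div]
    refine Finset.sum_le_sum fun i _ => (log_diff_le hc hX hXY (h.pos_left i)).trans ?_
    have := h.pos_left i
    refine div_le_div_of_nonneg_left (by positivity) (by positivity) ?_
    push_cast
    linarith
  simp only [Finset.sum_sub_distrib] at h1 h2 h3 ⊢
  linarith

lemma logGammaRatioSeq_sub_le {p : ℕ} {α β : Fin p → ℝ} (h : MajorizationConditions α β)
    {a b X Y : ℝ} (ha : 1 ≤ a) (hab : a ≤ b) (n : ℕ) (hX : 0 < X) (hXY : X ≤ Y) :
    logGammaRatioSeq (fun i => 1 / α i) (fun i => 1 / β i) X Y b n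
      - logGammaRatioSeq (fun i => 1 / α i) (fun i => 1 / β i) X Y a n
      ≤ (∑ i, 1 / α i * Y) / (n + 1) * (b - a) := by
  have hd := fun (t : ℝ) (ht : 1 ≤ t) => hasDerivAt_logGammaRatioSeq
    (A := fun i => 1 / α i) (B := fun i => 1 / β i) (fun i => one_div_pos.2 (h.pos_left i))
    (fun i => one_div_pos.2 (h.pos_right i)) hX (hX.trans_le hXY) (zero_lt_one.trans_le ht) n
  refine (convex_Ici (1 : ℝ)).image_sub_le_mul_sub_of_deriv_le
    (f := fun a => logGammaRatioSeq (fun i => 1 / α i) (fun i => 1 / β i) X Y a n)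
    (fun t ht => (hd t ht).continuousAt.continuousWithinAt)
    (fun t ht => (hd t (interior_subset ht)).differentiableAt.differentiableWithinAt)
    (fun t ht => ?_) a ha b (ha.trans hab) hab
  rw [(hd t (interior_subset ht)).deriv]
  exact logGammaRatioSeq_deriv_le h (interior_subset ht) n hX hXY

lemma gammaRatio_pos {p : ℕ} {A B : Fin p → ℝ} {X Y a : ℝ} (hA : ∀ i, 0 < A i)
    (hB : ∀ i, 0 < B i) (hX : 0 < X) (hY : 0 < Y) (ha : 0 < a) : 0 < gammaRatio A B X Y a := by
  have hG : ∀ {u v : ℝ}, 0 < u → 0 < v → 0 < Real.Gamma (u * v + a) :=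
    fun hu hv => Real.Gamma_pos_of_pos (by positivity)
  exact Finset.prod_pos fun i _ => div_pos (mul_pos (hG (hA i) hX) (hG (hB i) hY))
    (mul_pos (hG (hA i) hY) (hG (hB i) hX))

theorem mainTheorem9 {p : ℕ} (α β : Fin p → ℝ) (hαβ : MajorizationConditions α β)
    (A B : Fin p → ℝ) (hA : ∀ i, A i = 1 / α i) (hB : ∀ i, B i = 1 / β i)
    (X Y : ℝ) (hX : 0 < X) (hXY : X < Y) :
    AntitoneOn (fun a : ℝ => gammaRatio A B X Y a) (Set.Ici 1) := by
  obtain rfl : A = fun i => 1 / α i := funext hA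
  obtain rfl : B = fun i => 1 / β i := funext hB
  intro a ha b hb hab
  have hA' : ∀ i, 0 < 1 / α i := fun i => one_div_pos.2 (hαβ.pos_left i)
  have hB' : ∀ i, 0 < 1 / β i := fun i => one_div_pos.2 (hαβ.pos_right i)
  have hY := hX.trans hXY
  have ha' : 0 < a := zero_lt_one.trans_le ha
  have hb' : 0 < b := zero_lt_one.trans_le hb
  have hl := (tendsto_logGammaRatioSeq hA' hB' hX hY hb').sub
    (tendsto_logGammaRatioSeq hA' hB' hX hY ha')
  have hr : Filter.Tendsto (fun n : ℕ => (∑ i, 1 / α i * Y) / ((n : ℝ) + 1) * (b - a))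
      Filter.atTop (nhds (0 * (b - a))) :=
    ((Filter.tendsto_atTop_add_const_right _ 1
      tendsto_natCast_atTop_atTop).const_div_atTop _).mul_const _
  -- For each `n` the sequence may still increase by `O(1/n)`; only the limit is nonincreasing.
  have hle := le_of_tendsto_of_tendsto' hl hr
    fun n => logGammaRatioSeq_sub_le hαβ ha hab n hX hXY.le
  rw [zero_mul, sub_nonpos] at hle
  exact (Real.log_le_log_iff (gammaRatio_pos hA' hB' hX hY hb')
    (gammaRatio_pos hA' hB' hX hY ha')).1 hle
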